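/- **Theorem.** For a connected graph $X$ with vertex set $V$ let $\mathrm{dist}(u,v)$ be the number of edges of a shortest path from $u$ to $v$, and let $\Gamma_i(u)=\{v\in V:\mathrm{dist}(u,v)\le i\}$ for integers $i\ge 0$. A sequence $v_1,\dots,v_b$ of vertices is a *burning sequence* of length $b$ if $\bigcup_{1\le i\le b}\Gamma_{b-i}(v_i)=V$, and the *burning number* $\mathrm{burn}(X)$ is the minimum length of a burning sequence. (1) For integers $n\ge 1$ and $q\ge 2$, let $H(n,q)$ be the Hamming graph, whose vertices are the words of length $n$ over $\{1,\dots,q\}$, two words being adjacent if and only if they differ in exactly one position. Then $$\left\lfloor\left(1-\frac1q\right)n\right\rfloor+1\;\le\;\mathrm{burn}(H(n,q))\;\le\;\left\lfloor\left(1-\frac1q\right)n+\frac{q+1}2\right\rfloor .$$ (2) For integers $k\ge 1$ and $n\ge 2k$, let $J(n,k)$ be the Johnson graph, whose vertices are the $k$-element subsets of $\{1,\dots,n\}$, two subsets $u,v$ being adjacent if and only if $|u\cap v|=k-1$. Then $$\left\lceil\left(1-\frac kn\right)k\right\rceil+1\;\le\;\mathrm{burn}(J(n,k))\;\le\;\left\lfloor\left(1-\frac1{\lceil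 n/k\rceil}\right)k+\frac12\left(\left\lceil\frac nk\right\rceil+1\right)\right\rfloor .$$ (3) For an integer $n\ge 2$, let $\tfrac12H(n,2)$ be the halved $n$-cube, whose vertices are the vectors $x\in\mathbb F_2^n$ with $\sum_{i=1}^n x_i=0$, two vectors being adjacent if and only if they differ in exactly two positions. Then $$\mathrm{burn}\big(\tfrac12H(n,2)\big)=\left\lceil\frac n4\right\rceil+1 .$$ -/

import Mathlib

namespace Burning

/-- The `i`-neighbor `Γ_i(u)` of a vertex `u`: all vertices at distance at most `i` from `u`.
The extended distance is used, so that vertices in another component are never included;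
on a connected graph this is the usual distance. -/
def neighbor {V : Type*} (G : SimpleGraph V) (i : ℕ) (u : V) : Set V :=
  {v | G.edist u v ≤ (i : ℕ∞)}

/-- A sequence of `b` vertices is a burning sequence when the sets `Γ_{b-i}(v_i)`, `1 ≤ i ≤ b`,
cover the vertex set. The sequence is indexed from `0` here, so `v i` is the vertex burned at
time `i + 1`, and the natural-number subtraction never truncates. -/
def IsBurningSequence {V : Type*} (G : SimpleGraph V) (b : ℕ) (v : Fin b → V) : Prop :=
  (⋃ i : Fin b, neighbor G (b - (i.val + 1)) (v i)) = Set.univ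

/-- The burning number: the minimum length of a burning sequence. (A finite graph always has a
burning sequence, so the infimum is attained.) -/
noncomputable def burn {V : Type*} (G : SimpleGraph V) : ℕ :=
  sInf {b : ℕ | ∃ v : Fin b → V, IsBurningSequence G b v}

/-- The Hamming graph `H(n,q)`: words of length `n` over an alphabet with `q` letters, adjacent
when they differ in exactly one position. -/
def hammingGraph (n q : ℕ) : SimpleGraph (Fin n → Fin q) where
  Adj x y := hammingDist x y = 1
  symm := ⟨fun x y h => by rw [hammingDist_comm]; exact h⟩
  loopless := ⟨fun x h => by simp at h⟩

/-- The Johnson graph `J(n,k)`: the `k`-subsets of an `n`-set, adjacent when they meet in exactly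
`k - 1` elements. -/
def johnsonGraph (n k : ℕ) : SimpleGraph {u : Finset (Fin n) // u.card = k} where
  Adj u v := (u.val ∩ v.val).card + 1 = k
  symm := ⟨fun u v h => by rw [Finset.inter_comm]; exact h⟩
  loopless := ⟨fun u h => by simp [u.property] at h⟩

/-- The halved `n`-cube: the binary words of length `n` with even weight, adjacent when they
differ in exactly two positions. -/
def halvedCube (n : ℕ) : SimpleGraph {x : Fin n → ZMod 2 // ∑ i, x i = 0} where
  Adj x y := hammingDist x.val y.val = 2
  symm := ⟨fun x y h => by rw [hammingDist_comm]; exact h⟩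
  loopless := ⟨fun x h => by simp at h⟩

end Burning

/-!
A burning sequence of length `b` with centres `v 0, …, v (b - 1)` fails exactly when some vertex `x`
has distance at least `b - i` from `v i` for every `i`.

The upper bounds for Hamming and Johnson graphs come from averaging (`burn_le_floor_of_sum_le`).
There are `q` constant words, and `⌈n / k⌉` sets of size `k` covering the ground set, whose total
distance to any vertex is at most `(q - 1) * n`, respectively `(⌈n / k⌉ - 1) * k`. For the halved
cube two centres, the zero word and essentially the all-ones word, already suffice.

The lower bounds come from one rounding lemma in the style of Beck and Fiala (`exists_rounding`). A
vertex of each of the graphs is a `0`-`1` point of a product of simplices or of a hypersimplex, and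
at the centre of this polytope the agreement with every `v i` has its average value. Moving through
faces of decreasing dimension while keeping the agreement with `v i` fixed as long as the dimension
exceeds `i` reaches a vertex whose agreement with `v i` exceeds the average by at most `i`, which is
just what the decreasing radii `b - (i + 1)` tolerate. The dimension count leaves no room to fix the
agreement with `v 0`, but it can be prevented from increasing since every line has two directions;
this gives the rounding up in the Johnson bound and, with a parity correction of one bit, the exact
value for the halved cube.
-/

namespace Burning

/-! ### Rounding with small discrepancy -/

/-- The coordinates of a point of the cube `[0,1]^ι` that are strictly between `0` and `1`. -/
def floating {ι : Type*} [Fintype ι] (x : ι → ℚ) : Finset ι := {e | 0 < x e ∧ x e < 1}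

/-- Fewer linear equations than floating coordinates leave a line along which the point can move
inside the face of the cube until another coordinate becomes integral. As both directions of the
line are available, one further functional `c` can be kept from increasing. -/
theorem exists_move {ι κ : Type*} [Fintype ι] [DecidableEq ι] [Fintype κ] (x : ι → ℚ)
    (h0 : ∀ e, 0 ≤ x e) (h1 : ∀ e, x e ≤ 1) (a : κ → ι → ℚ) (c : ι → ℚ)
    (hκ : Fintype.card κ < (floating x).card) :
    ∃ y : ι → ℚ, (∀ e, 0 ≤ y e) ∧ (∀ e, y e ≤ 1) ∧ (∀ e ∉ floating x, y e = x e) ∧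
      (∀ k, ∑ e, a k e * y e = ∑ e, a k e * x e) ∧ ∑ e, c e * y e ≤ ∑ e, c e * x e ∧
      floating y ⊂ floating x := by
  classical
  obtain ⟨d, hd0, hdF, hda, hdc⟩ : ∃ d : ι → ℚ, d ≠ 0 ∧ (∀ e ∉ floating x, d e = 0) ∧
      (∀ k, ∑ e, a k e * d e = 0) ∧ ∑ e, c e * d e ≤ 0 := by
    obtain ⟨d, hd0, hdF, hda⟩ : ∃ d : ι → ℚ, d ≠ 0 ∧ (∀ e ∉ floating x, d e = 0) ∧
        (∀ k, ∑ e, a k e * d e = 0) := by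
      let L : (floating x → ℚ) →ₗ[ℚ] (κ → ℚ) :=
        Matrix.mulVecLin (Matrix.of fun k e => a k e.1)
      have hL : LinearMap.ker L ≠ ⊥ := LinearMap.ker_ne_bot_of_finrank_lt (by simpa using hκ)
      obtain ⟨d, hd, hd0⟩ := (Submodule.ne_bot_iff _).1 hL
      refine ⟨fun e => if h : e ∈ floating x then d ⟨e, h⟩ else 0, ?_, ?_, ?_⟩
      · intro h
        apply hd0
        ext e
        have := congrFun h e.1
        simpa using this
      · intro e he
        simp [he]
      · intro k
        have := congrFun (LinearMap.mem_ker.1 hd) k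
        simp only [L, Matrix.mulVecLin_apply, Matrix.mulVec, dotProduct, Matrix.of_apply,
          Pi.zero_apply] at this
        refine Eq.trans ?_ this
        rw [← Finset.sum_subset (Finset.subset_univ (floating x)), ← Finset.sum_coe_sort]
        · simp
        · intro e _ he
          simp [he]
    rcases le_total (∑ e, c e * d e) 0 with h | h
    · exact ⟨d, hd0, hdF, hda, h⟩
    · refine ⟨-d, neg_ne_zero.2 hd0, fun e he => by simp [hdF e he], fun k => ?_, ?_⟩
      · simp [hda k]
      · simpa using h
  -- `r e` is the time at which coordinate `e` reaches the boundary of `[0,1]`.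
  let r : ι → ℚ := fun e => if 0 < d e then (1 - x e) / d e else x e / (-d e)
  obtain ⟨e₀, he₀⟩ : ∃ e, d e ≠ 0 := Function.ne_iff.1 hd0
  obtain ⟨m, hm, hmin⟩ := Finset.exists_min_image (Finset.univ.filter fun e => d e ≠ 0) r
    ⟨e₀, by simpa using he₀⟩
  simp only [Finset.mem_filter, Finset.mem_univ, true_and] at hm hmin
  have hr : 0 ≤ r m := by
    simp only [r]
    split_ifs with h
    · exact div_nonneg (by linarith [h1 m]) h.le
    · exact div_nonneg (h0 m) (by linarith)
  have hy0 : ∀ e, 0 ≤ x e + r m * d e := by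
    intro e
    rcases lt_trichotomy (d e) 0 with h | h | h
    · have := hmin e h.ne
      rw [show r e = x e / (-d e) by simp [r, h.not_gt], le_div_iff₀ (by linarith)] at this
      linarith
    · simpa [h] using h0 e
    · have := mul_nonneg hr h.le
      linarith [h0 e]
  have hy1 : ∀ e, x e + r m * d e ≤ 1 := by
    intro e
    rcases lt_trichotomy (d e) 0 with h | h | h
    · have := mul_nonneg hr (neg_nonneg.2 h.le)
      linarith [h1 e]
    · simpa [h] using h1 e
    · have := hmin e h.ne'
      rw [show r e = (1 - x e) / d e by simp [r, h], le_div_iff₀ h] at this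
      linarith
  have hsum : ∀ a : ι → ℚ, ∑ e, a e * (x e + r m * d e) =
      ∑ e, a e * x e + r m * ∑ e, a e * d e := by
    intro a
    rw [Finset.mul_sum, ← Finset.sum_add_distrib]
    exact Finset.sum_congr rfl fun e _ => by ring
  refine ⟨fun e => x e + r m * d e, hy0, hy1, fun e he => by simp [hdF e he],
    fun k => by rw [hsum, hda k]; simp, ?_, ?_⟩
  · rw [hsum]
    linarith [mul_nonpos_of_nonneg_of_nonpos hr hdc]
  · rw [Finset.ssubset_iff_of_subset]
    · refine ⟨m, by_contra fun h => hm (hdF m h), ?_⟩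
      simp only [floating, Finset.mem_filter, Finset.mem_univ, true_and, not_and_or, not_lt]
      rcases lt_or_gt_of_ne hm with h | h
      · left
        rw [show r m = x m / (-d m) by simp [r, h.not_gt], div_mul_eq_mul_div, div_neg,
          mul_div_cancel_right₀ _ hm]
        simp
      · right
        rw [show r m = (1 - x m) / d m by simp [r, h], div_mul_cancel₀ _ hm]
        simp
    · intro e he
      by_contra h
      simp only [floating, Finset.mem_filter, Finset.mem_univ, true_and] at he h
      have : d e = 0 := hdF e (by simpa [floating] using h)
      simp only [this, mul_zero, add_zero] at he
      exact h he

/-- Moving inside the face spanned by the floating coordinates without changing the sums over the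
parts of a partition changes the sum over any set by at most the dimension left: a part whose
floating coordinates all lie in the set contributes nothing, and any other part misses at least one
of its floating coordinates. -/
theorem sum_le_sum_add_card_floating_sub {ι J : Type*} [Fintype ι] [DecidableEq ι] [DecidableEq J]
    (π : ι → J) (S : Finset ι) {x y : ι → ℚ} (hx0 : ∀ e, 0 ≤ x e) (hy1 : ∀ e, y e ≤ 1)
    (hxy : ∀ e ∉ floating x, y e = x e)
    (hπ : ∀ j, ∑ e with π e = j, y e = ∑ e with π e = j, x e) :
    ∑ e ∈ S, y e ≤ ∑ e ∈ S, x e +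
      ((floating x).card - ((floating x).image π).card : ℚ) := by
  set F := floating x with hF
  have hS : ∑ e ∈ S, y e - ∑ e ∈ S, x e = ∑ e ∈ F, if e ∈ S then y e - x e else 0 := by
    rw [← Finset.sum_sub_distrib, ← Finset.sum_filter]
    symm
    apply Finset.sum_subset_zero_on_sdiff
    · intro e he
      exact (Finset.mem_filter.1 he).2
    · intro e he
      have : e ∉ F := fun h => by simp_all
      simp [hxy e this]
    · intros; rfl
  have key : ∀ j ∈ F.image π, (∑ e ∈ F with π e = j, if e ∈ S then y e - x e else 0) ≤
      ((F.filter fun e => π e = j).card : ℚ) - 1 := by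
    intro j hj
    have hterm : ∀ e, (if e ∈ S then y e - x e else 0) ≤ 1 := by
      intro e
      split_ifs
      · linarith [hx0 e, hy1 e]
      · norm_num
    by_cases hall : ∀ e ∈ F, π e = j → e ∈ S
    · have h1 : (∑ e ∈ F with π e = j, if e ∈ S then y e - x e else 0) = 0 := by
        have h2 : ∑ e with π e = j, (y e - x e) = 0 := by
          rw [Finset.sum_sub_distrib, hπ j, sub_self]
        rw [← h2]
        apply Finset.sum_subset_zero_on_sdiff
        · exact Finset.filter_subset_filter _ (Finset.subset_univ _)
        · intro e he
          have : e ∉ F := fun h => by simp_all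
          simp [hxy e this]
        · intro e he
          rw [if_pos (hall e (Finset.mem_filter.1 he).1 (Finset.mem_filter.1 he).2)]
      rw [h1, sub_nonneg, Nat.one_le_cast, Nat.one_le_iff_ne_zero, Finset.card_ne_zero]
      obtain ⟨e, he, rfl⟩ := Finset.mem_image.1 hj
      exact ⟨e, by simp [he]⟩
    · push Not at hall
      obtain ⟨e, heF, hej, heS⟩ := hall
      have hmem : e ∈ F.filter fun e => π e = j := by simp [heF, hej]
      rw [← Finset.add_sum_erase _ _ hmem, if_neg heS, zero_add,
        ← Nat.cast_pred (Finset.card_pos.2 ⟨e, hmem⟩), ← Finset.card_erase_of_mem hmem]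
      exact (Finset.sum_le_card_nsmul _ _ 1 fun e _ => hterm e).trans (by simp)
  have h := Finset.sum_le_sum key
  rw [Finset.sum_fiberwise_of_maps_to (fun e he => Finset.mem_image_of_mem π he), ← hS,
    Finset.sum_sub_distrib, ← Nat.cast_sum,
    ← Finset.card_eq_sum_card_image] at h
  simp only [Finset.sum_const, nsmul_eq_mul, mul_one] at h
  linarith

/-- A part with integral sum cannot contain exactly one floating coordinate, so the dimension left
is positive unless the point is integral. -/
theorem card_image_floating_lt {ι J : Type*} [Fintype ι] [DecidableEq ι] [DecidableEq J]
    (π : ι → J) {x : ι → ℚ} (h0 : ∀ e, 0 ≤ x e) (h1 : ∀ e, x e ≤ 1)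
    (hint : ∀ j, ∃ z : ℤ, ∑ e with π e = j, x e = z) (hF : (floating x).Nonempty) :
    ((floating x).image π).card < (floating x).card := by
  refine lt_of_le_of_ne Finset.card_image_le fun hcard => ?_
  have hinj := Finset.card_image_iff.1 hcard
  obtain ⟨e, he⟩ := hF
  obtain ⟨z, hz⟩ := hint (π e)
  have hrest : ∃ w : ℤ, ∑ e' ∈ ({e' | π e' = π e} : Finset ι).erase e, x e' = w := by
    refine ⟨∑ e' ∈ ({e' | π e' = π e} : Finset ι).erase e, ⌊x e'⌋, ?_⟩
    push_cast
    refine Finset.sum_congr rfl fun e' he' => ?_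
    simp only [Finset.mem_erase, Finset.mem_filter, Finset.mem_univ, true_and] at he'
    have hnf : e' ∉ floating x := fun h => he'.1 (hinj h he he'.2)
    simp only [floating, Finset.mem_filter, Finset.mem_univ, true_and, not_and_or, not_lt] at hnf
    rcases hnf with h | h
    · rw [le_antisymm h (h0 e')]; simp
    · rw [le_antisymm (h1 e') h]; simp
  obtain ⟨w, hw⟩ := hrest
  have hmem : e ∈ ({e' | π e' = π e} : Finset ι) := by simp
  rw [← Finset.add_sum_erase _ _ hmem, hw] at hz
  simp only [floating, Finset.mem_filter, Finset.mem_univ, true_and] at he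
  have hx : x e = ((z - w : ℤ) : ℚ) := by push_cast; linarith
  rw [hx] at he
  have a1 : 0 < z - w := by exact_mod_cast he.1
  have a2 : z - w < 1 := by exact_mod_cast he.2
  omega

/-- A point of the cube whose sums over the parts of a partition are integral can be rounded to a
vertex of the cube with the same sums, in such a way that the sum over the `i`-th member of a given
sequence of sets grows by at most `i`. -/
theorem exists_rounding {ι J : Type*} [Fintype ι] [DecidableEq ι] [DecidableEq J]
    (π : ι → J) (S : ℕ → Finset ι) (x : ι → ℚ) (h0 : ∀ e, 0 ≤ x e) (h1 : ∀ e, x e ≤ 1)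
    (hint : ∀ j, ∃ z : ℤ, ∑ e with π e = j, x e = z) :
    ∃ y : ι → ℚ, (∀ e, y e = 0 ∨ y e = 1) ∧ (∀ e ∉ floating x, y e = x e) ∧
      (∀ j, ∑ e with π e = j, y e = ∑ e with π e = j, x e) ∧
      ∀ i, ∑ e ∈ S i, y e ≤ ∑ e ∈ S i, x e + i := by
  induction hn : (floating x).card using Nat.strong_induction_on generalizing x with
  | _ t ih =>
  rcases (floating x).eq_empty_or_nonempty with hF | hF
  · refine ⟨x, fun e => ?_, fun _ _ => rfl, fun _ => rfl, fun i => by simp⟩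
    have he : e ∉ floating x := by simp [hF]
    simp only [floating, Finset.mem_filter, Finset.mem_univ, true_and, not_and_or, not_lt] at he
    exact he.imp (fun h => le_antisymm h (h0 e)) (fun h => le_antisymm (h1 e) h)
  have hlt := card_image_floating_lt π h0 h1 hint hF
  -- With `D` the dimension left, the sums over `S 1, …, S (D - 1)` are kept exactly, the sum over
  -- `S 0` is kept from increasing, and no control is needed for `S i` with `D ≤ i`.
  set D := (floating x).card - ((floating x).image π).card with hD
  obtain ⟨y, hy0, hy1, hyx, hyeq, hyle, hss⟩ := exists_move (κ := (floating x).image π ⊕ Fin (D - 1))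
    x h0 h1
    (Sum.elim (fun j e => if π e = j then 1 else 0) (fun i e => if e ∈ S (i + 1) then 1 else 0))
    (fun e => if e ∈ S 0 then 1 else 0) (by simp; omega)
  have hyπ : ∀ j, ∑ e with π e = j, y e = ∑ e with π e = j, x e := by
    intro j
    by_cases hj : j ∈ (floating x).image π
    · simpa [Finset.sum_filter] using hyeq (Sum.inl ⟨j, hj⟩)
    · refine Finset.sum_congr rfl fun e he => hyx e fun h => hj ?_
      rw [← (Finset.mem_filter.1 he).2]
      exact Finset.mem_image_of_mem π h
  obtain ⟨z, hz01, hzy, hzπ, hzS⟩ := ih _ (hn ▸ Finset.card_lt_card hss) y hy0 hy1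
    (fun j => by rw [hyπ j]; exact hint j) rfl
  have hzx : ∀ e ∉ floating x, z e = x e := fun e he =>
    (hzy e fun h => he (hss.1 h)).trans (hyx e he)
  have hzπx : ∀ j, ∑ e with π e = j, z e = ∑ e with π e = j, x e := fun j =>
    (hzπ j).trans (hyπ j)
  refine ⟨z, hz01, hzx, hzπx, fun i => ?_⟩
  rcases le_or_gt D i with hi | hi
  · refine (sum_le_sum_add_card_floating_sub π (S i) h0
      (fun e => by rcases hz01 e with h | h <;> simp [h]) hzx hzπx).trans ?_
    rw [← Nat.cast_sub hlt.le]
    gcongr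
  · refine (hzS i).trans ?_
    gcongr ?_ + _
    rcases i with _ | i
    · simpa using hyle
    · exact le_of_eq (by simpa using hyeq (Sum.inr ⟨i, by omega⟩))

/-! ### Distance functions and burning sequences -/

/-- A function `δ` is the distance of `G` as soon as it vanishes exactly on the diagonal, changes by
at most one along an edge, and can be decreased along some edge off the diagonal. -/
theorem edist_eq_of_step {V : Type*} {G : SimpleGraph V} {δ : V → V → ℕ}
    (h0 : ∀ u v, δ u v = 0 ↔ u = v) (hadj : ∀ u w v, G.Adj u w → δ u v ≤ δ w v + 1)
    (hstep : ∀ u v, u ≠ v → ∃ w, G.Adj u w ∧ δ w v + 1 ≤ δ u v) (u v : V) :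
    G.edist u v = δ u v := by
  apply le_antisymm
  · have hwalk : ∀ n u, δ u v ≤ n → ∃ p : G.Walk u v, p.length ≤ n := by
      intro n
      induction n with
      | zero =>
        intro u hu
        obtain rfl := (h0 u v).1 (Nat.le_zero.1 hu)
        exact ⟨.nil, le_rfl⟩
      | succ n ih =>
        intro u hu
        by_cases huv : u = v
        · subst huv
          exact ⟨.nil, by simp⟩
        · obtain ⟨w, huw, hw⟩ := hstep u v huv
          obtain ⟨p, hp⟩ := ih w (by omega)
          exact ⟨.cons huw p, by simpa using hp⟩
    obtain ⟨p, hp⟩ := hwalk _ u le_rfl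
    exact p.edist_le.trans (by exact_mod_cast hp)
  · refine le_iInf fun p => ?_
    norm_cast
    induction p with
    | nil => simp [(h0 _ _).2 rfl]
    | cons h p ih =>
      rw [SimpleGraph.Walk.length_cons]
      exact (hadj _ _ _ h).trans (by omega)

theorem isBurningSequence_iff {V : Type*} {G : SimpleGraph V} {δ : V → V → ℕ}
    (hδ : ∀ u v, G.edist u v = δ u v) {b : ℕ} {v : Fin b → V} :
    IsBurningSequence G b v ↔ ∀ x, ∃ i : Fin b, δ (v i) x + i < b := by
  simp only [IsBurningSequence, neighbor, Set.eq_univ_iff_forall, Set.mem_iUnion,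
    Set.mem_ofPred_eq, hδ, Nat.cast_le]
  refine forall_congr' fun x => exists_congr fun i => ?_
  have := i.2
  omega

theorem burn_le {V : Type*} {G : SimpleGraph V} {b : ℕ} {v : Fin b → V}
    (h : IsBurningSequence G b v) : burn G ≤ b :=
  Nat.sInf_le ⟨v, h⟩

/-- Some burning sequence has length `burn G`, since any enumeration of the vertices is one; so the
infimum defining `burn` is not that of the empty set. -/
theorem exists_isBurningSequence_burn {V : Type*} [Finite V] (G : SimpleGraph V) :
    ∃ v : Fin (burn G) → V, IsBurningSequence G (burn G) v := by
  refine Nat.sInf_mem (s := {b | ∃ v : Fin b → V, IsBurningSequence G b v}) ?_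
  refine ⟨Nat.card V, (Finite.equivFin V).symm, ?_⟩
  refine Set.eq_univ_of_forall fun x => Set.mem_iUnion.2 ⟨Finite.equivFin V x, ?_⟩
  simp [neighbor]

/-- If the total distance from every vertex to `m` given centres is at most `(m - 1) * K`, then
lighting the centres in order burns the graph: a vertex missed by `b` steps is at distance at least
`b - i` from the `i`-th centre, counted from `0`, and the sum of these bounds is too large. -/
theorem burn_le_floor_of_sum_le {V : Type*} {G : SimpleGraph V} {δ : V → V → ℕ}
    (hδ : ∀ u v, G.edist u v = δ u v) {m K : ℕ} (hm : 1 ≤ m) (w : Fin m → V)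
    (hw : ∀ x, ∑ i, (δ (w i) x : ℚ) ≤ (m - 1) * K) :
    (burn G : ℤ) ≤ ⌊(1 - 1 / (m : ℚ)) * K + ((m : ℚ) + 1) / 2⌋ := by
  set q := (1 - 1 / (m : ℚ)) * K + ((m : ℚ) + 1) / 2 with hq
  have hm' : (1 : ℚ) ≤ m := by exact_mod_cast hm
  have hmq : (m : ℚ) * q = (m - 1) * K + m * (m + 1) / 2 := by
    rw [hq]; field_simp
  have hq0 : 0 ≤ q := by
    have : 0 ≤ (m : ℚ) * q := by
      rw [hmq]
      have := sub_nonneg.2 hm'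
      positivity
    exact nonneg_of_mul_nonneg_right this (by linarith)
  rw [← Int.natCast_floor_eq_floor hq0, Nat.cast_le]
  have hb := Nat.lt_floor_add_one q
  set b := ⌊q⌋₊
  -- When `b ≤ m` only the first `b` centres are used; otherwise the last one is repeated.
  refine burn_le (v := fun i : Fin b => w ⟨min i (m - 1), by omega⟩)
    ((isBurningSequence_iff hδ).2 fun x => ?_)
  by_contra! hx
  have hle : ∀ i : Fin m, (b : ℚ) - i ≤ δ (w i) x := by
    intro i
    rw [sub_le_iff_le_add]
    rcases lt_or_ge i.1 b with hi | hi
    · have := hx ⟨i, hi⟩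
      have hmin : (⟨min i.1 (m - 1), by omega⟩ : Fin m) = i := by
        ext; simp; omega
      rw [hmin] at this
      exact_mod_cast this
    · exact_mod_cast hi.trans (Nat.le_add_left _ _)
  have hsum := (Finset.sum_le_sum fun i (_ : i ∈ Finset.univ) => hle i).trans (hw x)
  have hgauss : ∑ i : Fin m, (i : ℚ) = m * (m - 1) / 2 := by
    rw [Fin.sum_univ_eq_sum_range (fun i => (i : ℚ)), eq_div_iff (by norm_num)]
    have := Finset.sum_range_id_mul_two m
    rw [← Nat.cast_pred (by omega), ← Nat.cast_sum]
    exact_mod_cast this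
  rw [Finset.sum_sub_distrib, hgauss] at hsum
  simp only [Finset.sum_const, Finset.card_univ, Fintype.card_fin, nsmul_eq_mul] at hsum
  have : (m : ℚ) * q < m * (b + 1) := by gcongr
  nlinarith

/-! ### Hamming graphs -/

/-- Rounding the uniform distribution in every position gives a word that agrees with the `i`-th of
the given words in at most `n / q + i` positions. -/
theorem exists_word_far {α : Type*} [Fintype α] [DecidableEq α] [Nonempty α] {n b : ℕ}
    (v : Fin b → Fin n → α) :
    ∃ x : Fin n → α, ∀ i, (n : ℚ) ≤ hammingDist (v i) x + n / Fintype.card α + i := by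
  have hq : (0 : ℚ) < Fintype.card α := by exact_mod_cast Fintype.card_pos
  have hrow : ∀ (y : Fin n × α → ℚ) j, ∑ e with e.1 = j, y e = ∑ a, y (j, a) := by
    intro y j
    rw [Finset.sum_filter, Fintype.sum_prod_type, Finset.sum_eq_single j] <;> simp +contextual
  let S : ℕ → Finset (Fin n × α) := fun i =>
    if h : i < b then Finset.univ.filter (fun e => v ⟨i, h⟩ e.1 = e.2) else ∅
  have hS : ∀ (y : Fin n × α → ℚ) (i : Fin b), ∑ e ∈ S i, y e = ∑ j, y (j, v i j) := by
    intro y i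
    simp [S, Finset.sum_filter, Fintype.sum_prod_type]
  obtain ⟨y, hy01, -, hyπ, hyS⟩ := exists_rounding (Prod.fst : Fin n × α → Fin n) S
    (fun _ => 1 / Fintype.card α) (fun _ => by positivity)
    (fun _ => by rw [div_le_one hq]; exact_mod_cast Fintype.card_pos)
    (fun j => ⟨1, by rw [hrow]; simp [hq.ne']⟩)
  have hy0 : ∀ e, 0 ≤ y e := fun e => by rcases hy01 e with h | h <;> simp [h]
  have hrow1 : ∀ j, ∑ a, y (j, a) = 1 := by
    intro j
    rw [← hrow, hyπ, hrow]; simp [hq.ne']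
  have hex : ∀ j, ∃ a, y (j, a) = 1 := by
    intro j
    by_contra! h
    have h1 := hrow1 j
    rw [Finset.sum_eq_zero fun a _ => (hy01 (j, a)).resolve_right (h a)] at h1
    exact zero_ne_one h1
  choose x hx using hex
  refine ⟨x, fun i => ?_⟩
  have h := hyS i
  rw [hS, hS] at h
  have hagree : (n : ℚ) - hammingDist (v i) x ≤ ∑ j, y (j, v i j) := by
    have h1 : ((n : ℚ) - hammingDist (v i) x) = ∑ j, if v i j ≠ x j then (0 : ℚ) else 1 := by
      have h2 : ∀ j, (if v i j ≠ x j then (0 : ℚ) else 1) = 1 - if v i j ≠ x j then 1 else 0 := by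
        intro j; split_ifs <;> simp
      simp only [h2, Finset.sum_sub_distrib, Finset.sum_boole, hammingDist]
      simp
    rw [h1]
    refine Finset.sum_le_sum fun j _ => ?_
    split_ifs with hj
    · exact hy0 _
    · rw [not_not.1 hj, hx]
  simp only [Finset.sum_const, Finset.card_univ, Fintype.card_fin, nsmul_eq_mul,
    mul_one_div] at h
  linarith

theorem hammingDist_update_add_one {n : ℕ} {α : Type*} [DecidableEq α] {u v : Fin n → α}
    {j : Fin n} (hj : u j ≠ v j) :
    hammingDist (Function.update u j (v j)) v + 1 = hammingDist u v := by
  have h : (Finset.univ.filter fun i => Function.update u j (v j) i ≠ v i) =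
      (Finset.univ.filter fun i => u i ≠ v i).erase j := by
    ext i
    by_cases hi : i = j
    · subst hi; simp
    · simp [hi]
  rw [hammingDist, h, hammingDist, Finset.card_erase_add_one (by simpa using hj)]

theorem hammingDist_update_self {n : ℕ} {α : Type*} [DecidableEq α] {u : Fin n → α}
    {j : Fin n} {a : α} (hj : u j ≠ a) : hammingDist u (Function.update u j a) = 1 := by
  have := hammingDist_update_add_one (u := u) (v := Function.update u j a) (j := j) (by simpa)
  simpa using this.symm

theorem edist_hammingGraph {n q : ℕ} (u v : Fin n → Fin q) :
    (hammingGraph n q).edist u v = hammingDist u v := by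
  refine edist_eq_of_step (fun u v => hammingDist_eq_zero) ?_ ?_ u v
  · intro u w v (h : hammingDist u w = 1)
    have := hammingDist_triangle u w v
    omega
  · intro u v huv
    obtain ⟨j, hj⟩ := Function.ne_iff.1 huv
    exact ⟨Function.update u j (v j), hammingDist_update_self hj, (hammingDist_update_add_one hj).le⟩

theorem floor_add_one_le_burn_hammingGraph {n q : ℕ} (hq : 1 ≤ q) :
    ⌊(1 - 1 / (q : ℚ)) * n⌋ + 1 ≤ (burn (hammingGraph n q) : ℤ) := by
  obtain ⟨v, hv⟩ := exists_isBurningSequence_burn (hammingGraph n q)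
  rw [isBurningSequence_iff edist_hammingGraph] at hv
  have : NeZero q := ⟨by omega⟩
  obtain ⟨x, hx⟩ := exists_word_far v
  obtain ⟨i, hi⟩ := hv x
  have hi' : (hammingDist (v i) x : ℚ) + i < burn (hammingGraph n q) := by exact_mod_cast hi
  have := hx i
  rw [Fintype.card_fin] at this
  have h : (1 - 1 / (q : ℚ)) * n < burn (hammingGraph n q) := by
    rw [sub_mul, one_div_mul_eq_div]
    linarith
  exact Int.floor_lt.2 (by exact_mod_cast h)

/-- The constant words are the centres: every position of a word agrees with exactly one of them. -/
theorem burn_hammingGraph_le_floor {n q : ℕ} (hq : 1 ≤ q) :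
    (burn (hammingGraph n q) : ℤ) ≤ ⌊(1 - 1 / (q : ℚ)) * n + ((q : ℚ) + 1) / 2⌋ := by
  refine burn_le_floor_of_sum_le edist_hammingGraph hq (fun i _ => i) fun x => le_of_eq ?_
  have h : ∀ i : Fin q, (hammingDist (fun _ => i) x : ℚ) = ∑ j, if i = x j then (0 : ℚ) else 1 := by
    intro i
    simp [hammingDist, Finset.sum_ite]
  have h2 : ∀ (i : Fin q) j, (if i = x j then (0 : ℚ) else 1) = 1 - if i = x j then 1 else 0 := by
    intro i j; split_ifs <;> simp
  simp only [h]
  rw [Finset.sum_comm]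
  simp [h2]
  ring

/-! ### Johnson graphs -/

theorem card_sdiff_le_card_sdiff_add {n : ℕ} (u w v : Finset (Fin n)) :
    (u \ v).card ≤ (u \ w).card + (w \ v).card :=
  (Finset.card_le_card (sdiff_triangle u w v)).trans (Finset.card_union_le _ _)

theorem johnsonGraph_adj_iff {n k : ℕ} {u v : {u : Finset (Fin n) // u.card = k}} :
    (johnsonGraph n k).Adj u v ↔ (u.1 \ v.1).card = 1 := by
  change (u.1 ∩ v.1).card + 1 = k ↔ _
  have := Finset.card_sdiff_add_card_inter u.1 v.1
  rw [u.2] at this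
  omega

theorem edist_johnsonGraph {n k : ℕ} (u v : {u : Finset (Fin n) // u.card = k}) :
    (johnsonGraph n k).edist u v = (u.1 \ v.1).card := by
  have h0 : ∀ u v : {u : Finset (Fin n) // u.card = k}, (u.1 \ v.1).card = 0 ↔ u = v := by
    intro u v
    rw [Finset.card_eq_zero, Finset.sdiff_eq_empty_iff_subset, Subtype.ext_iff]
    exact ⟨fun h => Finset.eq_of_subset_of_card_le h (by rw [u.2, v.2]), fun h => h.subset⟩
  refine edist_eq_of_step (δ := fun u v => (u.1 \ v.1).card) h0 ?_ ?_ u v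
  · intro u w v h
    have := card_sdiff_le_card_sdiff_add u.1 w.1 v.1
    rw [johnsonGraph_adj_iff.1 h] at this
    simpa [add_comm] using this
  · intro u v huv
    have hne : (u.1 \ v.1).Nonempty := Finset.card_ne_zero.1 (mt (h0 u v).1 huv)
    have hne' : (v.1 \ u.1).Nonempty := Finset.card_ne_zero.1 (mt (h0 v u).1 (Ne.symm huv))
    obtain ⟨a, ha⟩ := hne
    obtain ⟨c, hc⟩ := hne'
    rw [Finset.mem_sdiff] at ha hc
    have hca : c ∉ u.1.erase a := fun h => hc.2 (Finset.mem_of_mem_erase h)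
    refine ⟨⟨insert c (u.1.erase a), ?_⟩, johnsonGraph_adj_iff.2 ?_, ?_⟩
    · rw [Finset.card_insert_of_notMem hca, Finset.card_erase_add_one ha.1, u.2]
    · rw [Finset.card_eq_one]
      refine ⟨a, ?_⟩
      ext e
      simp only [Finset.mem_sdiff, Finset.mem_insert, Finset.mem_erase, Finset.mem_singleton]
      constructor
      · rintro ⟨h1, h2⟩
        by_contra h
        exact h2 (Or.inr ⟨h, h1⟩)
      · rintro rfl
        refine ⟨ha.1, ?_⟩
        rintro (rfl | h)
        · exact hc.2 ha.1
        · exact h.1 rfl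
    · have : insert c (u.1.erase a) \ v.1 = (u.1 \ v.1).erase a := by
        ext e
        simp only [Finset.mem_sdiff, Finset.mem_insert, Finset.mem_erase]
        constructor
        · rintro ⟨rfl | h, h2⟩
          · exact absurd hc.1 h2
          · exact ⟨h.1, h.2, h2⟩
        · rintro ⟨h1, h2, h3⟩
          exact ⟨Or.inr ⟨h1, h2⟩, h3⟩
      simp only [this]
      rw [Finset.card_erase_add_one (by simpa using ha)]

/-- Rounding the constant point `k / n` gives a `k`-set meeting the `i`-th of the given `k`-sets in
at most `k * k / n + i` points. -/
theorem exists_finset_card_inter_le {n k b : ℕ} (hn : 1 ≤ n) (hk : k ≤ n)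
    (v : Fin b → {u : Finset (Fin n) // u.card = k}) :
    ∃ x : {u : Finset (Fin n) // u.card = k}, ∀ i,
      (((v i).1 ∩ x.1).card : ℚ) ≤ k * (k / n) + i := by
  have hn0 : (0 : ℚ) < n := by exact_mod_cast hn
  let S : ℕ → Finset (Fin n) := fun i => if h : i < b then (v ⟨i, h⟩).1 else ∅
  have hS : ∀ i : Fin b, S i = (v i).1 := fun i => by simp [S]
  obtain ⟨y, hy01, -, hyπ, hyS⟩ := exists_rounding (fun _ : Fin n => ()) S
    (fun _ => (k : ℚ) / n) (fun _ => by positivity)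
    (fun _ => by rw [div_le_one hn0]; exact_mod_cast hk)
    (fun _ => ⟨k, by simp [mul_div_cancel₀ _ hn0.ne']⟩)
  have hy : ∀ e, y e = if y e = 1 then 1 else 0 := by
    intro e
    rcases hy01 e with h | h <;> simp [h]
  have hsum : ∀ s : Finset (Fin n), ∑ e ∈ s, y e = ((s ∩ Finset.univ.filter (y · = 1)).card : ℚ) := by
    intro s
    rw [Finset.sum_congr rfl fun e _ => hy e, Finset.sum_boole]
    congr 2
    ext e
    simp
  refine ⟨⟨Finset.univ.filter (y · = 1), ?_⟩, fun i => ?_⟩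
  · have h := hyπ ()
    rw [hsum] at h
    simp only [Finset.filter_true, Finset.univ_inter, Finset.sum_const, Finset.card_univ,
      Fintype.card_fin, nsmul_eq_mul, mul_div_cancel₀ _ hn0.ne'] at h
    exact_mod_cast h
  · have h := hyS i
    rw [hsum, hS] at h
    simpa [(v i).2] using h

theorem ceil_add_one_le_burn_johnsonGraph {n k : ℕ} (hn : 1 ≤ n) (hk : k ≤ n) :
    ⌈(1 - (k : ℚ) / n) * k⌉ + 1 ≤ (burn (johnsonGraph n k) : ℤ) := by
  obtain ⟨v, hv⟩ := exists_isBurningSequence_burn (johnsonGraph n k)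
  rw [isBurningSequence_iff edist_johnsonGraph] at hv
  obtain ⟨x, hx⟩ := exists_finset_card_inter_le hn hk v
  obtain ⟨i, hi⟩ := hv x
  have hc := Finset.card_sdiff_add_card_inter (v i).1 x.1
  rw [(v i).2] at hc
  -- The distance is an integer, so the bound `(1 - k / n) * k - i` on it may be rounded up.
  have h : ⌈(1 - (k : ℚ) / n) * k⌉ ≤ (((v i).1 \ x.1).card + i : ℕ) := by
    rw [Int.ceil_le]
    have h1 := hx i
    have h2 : (((v i).1 \ x.1).card : ℚ) + ((v i).1 ∩ x.1).card = k := by exact_mod_cast hc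
    push_cast
    linarith
  omega

/-- The centres are `k`-sets extending the blocks `{i * k, …, i * k + k - 1}`; together they cover
`{0, …, n - 1}`. -/
theorem burn_johnsonGraph_le_floor {n k : ℕ} (hk : 1 ≤ k) (hkn : k ≤ n) :
    (burn (johnsonGraph n k) : ℤ) ≤
      ⌊(1 - 1 / (⌈(n : ℚ) / k⌉ : ℚ)) * k + 1 / 2 * ((⌈(n : ℚ) / k⌉ : ℚ) + 1)⌋ := by
  have hk0 : (0 : ℚ) < k := by exact_mod_cast hk
  have hn0 : (0 : ℚ) < n := by exact_mod_cast hk.trans hkn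
  have hceil : ((⌈(n : ℚ) / k⌉ : ℤ) : ℚ) = ((⌈(n : ℚ) / k⌉₊ : ℕ) : ℚ) := by
    rw [← Int.natCast_ceil_eq_ceil (by positivity)]; simp
  have hle := Nat.le_ceil ((n : ℚ) / k)
  have hpos : 1 ≤ ⌈(n : ℚ) / k⌉₊ := Nat.ceil_pos.2 (by positivity)
  rw [hceil]
  set m := ⌈(n : ℚ) / k⌉₊
  have hmk : n ≤ m * k := by
    rw [div_le_iff₀ hk0] at hle
    exact_mod_cast hle
  have hblock : ∀ i : Fin m, ∃ u : {u : Finset (Fin n) // u.card = k},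
      ∀ e : Fin n, e.1 / k = i.1 → e ∈ u.1 := by
    intro i
    have hcard : (Finset.univ.filter fun e : Fin n => e.1 / k = i.1).card ≤ k := by
      calc _ ≤ (Finset.Ico (i.1 * k) (i.1 * k + k)).card := by
            refine Finset.card_le_card_of_injOn Fin.val (fun e he => ?_) Fin.val_injective.injOn
            simp only [Finset.coe_filter, Finset.mem_univ, true_and, Set.mem_ofPred_eq] at he
            rw [Nat.div_eq_iff hk] at he
            simp only [Finset.coe_Ico, Set.mem_Ico]
            omega
        _ = k := by simp
    obtain ⟨u, hu, huk⟩ := Finset.exists_superset_card_eq hcard (by simpa using hkn)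
    exact ⟨⟨u, huk⟩, fun e he => hu (by simpa using he)⟩
  choose w hw using hblock
  rw [show 1 / 2 * ((m : ℚ) + 1) = (m + 1) / 2 by ring]
  refine burn_le_floor_of_sum_le edist_johnsonGraph hpos w fun x => ?_
  have hcover : k ≤ ∑ i, ((w i).1 ∩ x.1).card := by
    calc k = x.1.card := x.2.symm
      _ ≤ (Finset.univ.biUnion fun i => (w i).1 ∩ x.1).card := by
          refine Finset.card_le_card fun e he => ?_
          rw [Finset.mem_biUnion]
          exact ⟨⟨e.1 / k, (Nat.div_lt_iff_lt_mul hk).2 (e.2.trans_le hmk)⟩, Finset.mem_univ _,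
            Finset.mem_inter.2 ⟨hw _ e rfl, he⟩⟩
      _ ≤ _ := Finset.card_biUnion_le
  have hsum : ∀ i, (((w i).1 \ x.1).card : ℚ) = k - ((w i).1 ∩ x.1).card := by
    intro i
    have := Finset.card_sdiff_add_card_inter (w i).1 x.1
    rw [(w i).2] at this
    rw [eq_sub_iff_add_eq]
    exact_mod_cast this
  have hcover' : (k : ℚ) ≤ ∑ i, (((w i).1 ∩ x.1).card : ℚ) := by exact_mod_cast hcover
  simp only [hsum, Finset.sum_sub_distrib, Finset.sum_const, Finset.card_univ, Fintype.card_fin,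
    nsmul_eq_mul]
  linarith

/-! ### Halved cubes -/

theorem zmod_two_sub_eq_ite (a b : ZMod 2) : a - b = if a ≠ b then 1 else 0 := by
  revert a b; decide

/-- The parity of the Hamming distance of two binary words is the sum of the parities of their
weights. -/
theorem natCast_hammingDist {n : ℕ} (u v : Fin n → ZMod 2) :
    (hammingDist u v : ZMod 2) = ∑ i, u i - ∑ i, v i := by
  rw [← Finset.sum_sub_distrib, Finset.sum_congr rfl fun i _ => zmod_two_sub_eq_ite _ _,
    Finset.sum_boole, hammingDist]

theorem even_hammingDist_iff {n : ℕ} (u v : Fin n → ZMod 2) :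
    Even (hammingDist u v) ↔ ∑ i, u i = ∑ i, v i := by
  rw [← ZMod.natCast_eq_zero_iff_even, natCast_hammingDist, sub_eq_zero]

theorem even_hammingDist_of_sum_eq_zero {n : ℕ} (u v : {x : Fin n → ZMod 2 // ∑ i, x i = 0}) :
    Even (hammingDist u.1 v.1) :=
  (even_hammingDist_iff _ _).2 (u.2.trans v.2.symm)

theorem edist_halvedCube {n : ℕ} (u v : {x : Fin n → ZMod 2 // ∑ i, x i = 0}) :
    (halvedCube n).edist u v = (hammingDist u.1 v.1 / 2 : ℕ) := by
  have h0 : ∀ u v : {x : Fin n → ZMod 2 // ∑ i, x i = 0},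
      hammingDist u.1 v.1 / 2 = 0 ↔ u = v := by
    intro u v
    rw [Subtype.ext_iff, ← hammingDist_eq_zero]
    have := even_hammingDist_of_sum_eq_zero u v
    grind
  refine edist_eq_of_step (δ := fun u v => hammingDist u.1 v.1 / 2) h0 ?_ ?_ u v
  · intro u w v (h : hammingDist u.1 w.1 = 2)
    have := hammingDist_triangle u.1 w.1 v.1
    omega
  · intro u v huv
    have heven := even_hammingDist_of_sum_eq_zero u v
    obtain ⟨i, hi⟩ := Function.ne_iff.1 (Subtype.coe_injective.ne huv)
    have h1 := hammingDist_update_add_one hi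
    set u' := Function.update u.1 i (v.1 i) with hu'
    have hne : u' ≠ v.1 := by
      intro h
      rw [h, hammingDist_self] at h1
      rw [← h1] at heven
      exact absurd heven (by decide)
    obtain ⟨j, hj⟩ := Function.ne_iff.1 hne
    have h2 := hammingDist_update_add_one hj
    have h3 : hammingDist u.1 u' = 1 := hammingDist_update_self hi
    have h4 := hammingDist_update_self hj
    set w := Function.update u' j (v.1 j) with hw
    have hw_even : Even (hammingDist w v.1) := by
      rw [← h1, ← h2] at heven
      grind
    have huw := hammingDist_triangle u.1 u' w
    have huw' := hammingDist_triangle u.1 w v.1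
    refine ⟨⟨w, ((even_hammingDist_iff _ _).1 hw_even).trans v.2⟩, ?_, ?_⟩
    · change hammingDist u.1 w = 2
      omega
    · change hammingDist w v.1 / 2 + 1 ≤ hammingDist u.1 v.1 / 2
      omega

/-- Rounding gives a word far from all given words, and changing one bit corrects the parity of its
weight. That bit is chosen where the word agrees with the first given word, unless they are
antipodal, so that the distance to the first word does not drop below `n / 2`; the other distances
may decrease by one. -/
theorem exists_even_word_far {n b : ℕ} (hn : 2 ≤ n)
    (v : Fin b → {x : Fin n → ZMod 2 // ∑ i, x i = 0}) :
    ∃ x : {x : Fin n → ZMod 2 // ∑ i, x i = 0}, ∀ i,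
      n ≤ 2 * (hammingDist (v i).1 x.1 + i + if i.1 = 0 then 0 else 1) := by
  obtain ⟨x, hx⟩ := exists_word_far fun i => (v i).1
  have hx' : ∀ i, n ≤ 2 * (hammingDist (v i).1 x + i) := by
    intro i
    have := hx i
    rw [ZMod.card, Nat.cast_ofNat] at this
    have h : (n : ℚ) ≤ 2 * (hammingDist (v i).1 x + i) := by linarith
    exact_mod_cast h
  by_cases hsum : ∑ i, x i = 0
  · exact ⟨⟨x, hsum⟩, fun i => (hx' i).trans (by simp only; omega)⟩
  have hodd : ∀ i, ¬ Even (hammingDist (v i).1 x) := fun i h =>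
    hsum (((even_hammingDist_iff _ _).1 h).symm.trans (v i).2)
  have hupd : ∀ (u : Fin n → ZMod 2) j, hammingDist u x ≤
      hammingDist u (Function.update x j (x j + 1)) + 1 := by
    intro u j
    have h1 := hammingDist_triangle u (Function.update x j (x j + 1)) x
    rwa [hammingDist_comm (Function.update x j (x j + 1)), hammingDist_update_self (by simp)] at h1
  have heven : ∀ j, ∑ i, Function.update x j (x j + 1) i = 0 := by
    intro j
    have h1 := natCast_hammingDist x (Function.update x j (x j + 1))
    rw [hammingDist_update_self (by simp)] at h1
    have h2 : ∀ a c : ZMod 2, a ≠ 0 → ((1 : ℕ) : ZMod 2) = a - c → c = 0 := by decide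
    exact h2 _ _ hsum h1
  obtain ⟨j, hj⟩ : ∃ j, ∀ i : Fin b, i.1 = 0 →
      n ≤ 2 * hammingDist (v i).1 (Function.update x j (x j + 1)) := by
    by_cases hag : ∃ (i : Fin b) (j : Fin n), i.1 = 0 ∧ (v i).1 j = x j
    · obtain ⟨i, j, hi0, hij⟩ := hag
      refine ⟨j, fun i' hi' => ?_⟩
      obtain rfl : i' = i := Fin.ext (hi'.trans hi0.symm)
      have h1 := hammingDist_update_add_one (u := Function.update x j (x j + 1)) (v := (v i').1)
        (j := j) (by simp [hij])
      rw [hij, Function.update_idem, Function.update_eq_self, hammingDist_comm,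
        hammingDist_comm _ (v i').1] at h1
      have := hx' i'
      omega
    · push Not at hag
      refine ⟨⟨0, by omega⟩, fun i hi => ?_⟩
      have h1 := hupd (v i).1 ⟨0, by omega⟩
      have h2 : hammingDist (v i).1 x = n := by
        simp [hammingDist, Finset.filter_true_of_mem fun j _ => hag i j hi]
      omega
  refine ⟨⟨_, heven j⟩, fun i => ?_⟩
  by_cases hi : i.1 = 0
  · have := hj i hi
    simp only [hi, if_true]
    omega
  · have h1 := hx' i
    have h2 := hupd (v i).1 j
    simp only [hi, if_false]
    omega

theorem le_four_mul_burn_halvedCube_sub_one {n : ℕ} (hn : 2 ≤ n) :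
    n ≤ 4 * (burn (halvedCube n) - 1) := by
  obtain ⟨v, hv⟩ := exists_isBurningSequence_burn (halvedCube n)
  rw [isBurningSequence_iff edist_halvedCube] at hv
  obtain ⟨x, hx⟩ := exists_even_word_far hn v
  obtain ⟨i, hi⟩ := hv x
  have h1 := hx i
  obtain ⟨d, hd⟩ := even_hammingDist_of_sum_eq_zero (v i) x
  split_ifs at h1 <;> omega

/-- The centres are the zero word and an even word at Hamming distance at most one from the all-ones
word. Every other step may light an arbitrary vertex. -/
theorem burn_halvedCube_le {n c : ℕ} (hn : 1 ≤ n) (hc : n ≤ 4 * c) :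
    burn (halvedCube n) ≤ c + 1 := by
  obtain ⟨y, hy⟩ : ∃ y : {x : Fin n → ZMod 2 // ∑ i, x i = 0},
      hammingDist y.1 1 ≤ n % 2 := by
    have hcast : ∑ i : Fin n, (1 : Fin n → ZMod 2) i = n := by simp
    rcases Nat.even_or_odd n with h | h
    · exact ⟨⟨1, hcast.trans (ZMod.natCast_eq_zero_iff_even.2 h)⟩, by simp⟩
    · have h1 : hammingDist (1 : Fin n → ZMod 2) (Function.update 1 ⟨0, hn⟩ 0) = 1 :=
        hammingDist_update_self (by simp)
      refine ⟨⟨Function.update 1 ⟨0, hn⟩ 0, ?_⟩, ?_⟩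
      · have h2 := natCast_hammingDist (1 : Fin n → ZMod 2) (Function.update 1 ⟨0, hn⟩ 0)
        rw [h1, hcast, ZMod.natCast_eq_one_iff_odd.2 h] at h2
        exact sub_eq_self.1 h2.symm
      · rw [hammingDist_comm, h1, Nat.odd_iff.1 h]
  refine burn_le (v := fun i : Fin (c + 1) => if i.1 = 0 then ⟨0, by simp⟩ else y)
    ((isBurningSequence_iff edist_halvedCube).2 fun x => ?_)
  obtain ⟨d, hd⟩ := even_hammingDist_of_sum_eq_zero ⟨0, by simp⟩ x
  obtain ⟨e, he⟩ := even_hammingDist_of_sum_eq_zero y x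
  simp only at hd he
  have hcompl : hammingDist 0 x.1 + hammingDist 1 x.1 = n := by
    have h : ∀ a : ZMod 2, 1 ≠ a ↔ ¬ 0 ≠ a := by decide
    simp only [hammingDist, Pi.zero_apply, Pi.one_apply, h]
    rw [Finset.card_filter_add_card_filter_not]
    simp
  have htri := hammingDist_triangle y.1 1 x.1
  by_cases hdc : d ≤ c
  · refine ⟨0, ?_⟩
    simp only [Fin.val_zero, if_true]
    omega
  · refine ⟨⟨1, by omega⟩, ?_⟩
    simp only [one_ne_zero, if_false]
    omega

theorem burn_halvedCube {n : ℕ} (hn : 2 ≤ n) :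
    (burn (halvedCube n) : ℤ) = ⌈(n : ℚ) / 4⌉ + 1 := by
  have h1 := le_four_mul_burn_halvedCube_sub_one hn
  have h2 := burn_halvedCube_le (n := n) (c := (n + 3) / 4) (by omega) (by omega)
  have h3 : ⌈(n : ℚ) / 4⌉ = (((n + 3) / 4 : ℕ) : ℤ) := by
    have h4 : n ≤ 4 * ((n + 3) / 4) := by omega
    have h5 : 4 * ((n + 3) / 4) < n + 4 := by omega
    have h4' : (n : ℚ) ≤ 4 * (((n + 3) / 4 : ℕ) : ℚ) := by exact_mod_cast h4
    have h5' : 4 * (((n + 3) / 4 : ℕ) : ℚ) < n + 4 := by exact_mod_cast h5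
    rw [Int.ceil_eq_iff, Int.cast_natCast]
    constructor <;> linarith
  rw [h3]
  omega

end Burning

theorem theorem1p3 :
    (∀ n q : ℕ, 1 ≤ n → 2 ≤ q →
      ⌊(1 - 1 / (q : ℚ)) * (n : ℚ)⌋ + 1 ≤ (Burning.burn (Burning.hammingGraph n q) : ℤ) ∧
      (Burning.burn (Burning.hammingGraph n q) : ℤ) ≤
        ⌊(1 - 1 / (q : ℚ)) * (n : ℚ) + ((q : ℚ) + 1) / 2⌋) ∧
    (∀ n k : ℕ, 1 ≤ k → 2 * k ≤ n →
      ⌈(1 - (k : ℚ) / (n : ℚ)) * (k : ℚ)⌉ + 1 ≤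
        (Burning.burn (Burning.johnsonGraph n k) : ℤ) ∧
      (Burning.burn (Burning.johnsonGraph n k) : ℤ) ≤
        ⌊(1 - 1 / (⌈(n : ℚ) / (k : ℚ)⌉ : ℚ)) * (k : ℚ) +
          1 / 2 * ((⌈(n : ℚ) / (k : ℚ)⌉ : ℚ) + 1)⌋) ∧
    (∀ n : ℕ, 2 ≤ n →
      (Burning.burn (Burning.halvedCube n) : ℤ) = ⌈(n : ℚ) / 4⌉ + 1) := by
  refine ⟨fun n q _ hq => ?_, fun n k hk hkn => ?_, fun n hn => Burning.burn_halvedCube hn⟩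
  · exact ⟨Burning.floor_add_one_le_burn_hammingGraph (by omega),
      Burning.burn_hammingGraph_le_floor (by omega)⟩
  · exact ⟨Burning.ceil_add_one_le_burn_johnsonGraph (by omega) (by omega),
      Burning.burn_johnsonGraph_le_floor hk (by omega)⟩
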